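/- Let $n\ge 2$ users $1,\dots,n$ be arranged on the directed ring $1\to2\to\cdots\to n\to1$, let $K\in\mathbb N$, and let user $u$ hold contributions $x_u^1,\dots,x_u^K\in X$, where $X\subseteq\mathbb R$. Let $\mathrm{Perturb}(x;\sigma_{loc})=x+Z$ add to $x$ a fresh independent noise value $Z$ from a fixed law with mean $0$ and standard deviation $\sigma_{loc}$, and suppose that $\mathrm{Perturb}(\cdot;\sigma_{loc})$ is $(\varepsilon,\delta)$-locally differentially private on $X$, i.e. $\mathbb P(\mathrm{Perturb}(x;\sigma_{loc})\in S)\le e^{\varepsilon}\,\mathbb P(\mathrm{Perturb}(x';\sigma_{loc})\in S)+\delta$ for all $x,x'\in X$ and measurable $S\subseteq\mathbb R$, with $\varepsilon,\delta>0$. Consider the following protocol. Start with $\tau=0$, $a=0$. For $k=1,\dots,K$ and, within each round, $u=1,\dots,n$: if $a=0$, user $u$ sets $\tau\leftarrow\tau+\mathrm{Perturb}(x_u^k;\sigma_{loc})$ and $a\leftarrow n-2$; otherwise user $u$ sets $\tau\leftarrow\tau+x_u^k$ and $a\leftarrow a-1$; then $u$ sends $\tau$ to the next user on the ring. After $K$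 rounds, return $\tau$. The view of a user consists of the messages (with sender and receiver) that this user sends or receives. The protocol is called $(\alpha,\beta)$-network DP if for all distinct users $u\ne v$, all datasets $D,D'$ (with contributions in $X$) that differ only in the contributions of $u$, and all measurable sets $S$ of views, $\mathbb P(\mathrm{view}_v(D)\in S)\le e^{\alpha}\,\mathbb P(\mathrm{view}_v(D')\in S)+\beta$. Then: 1. Noise enters the sum once every $n-1$ hops: if the $Kn$ steps are numbered $0,1,\dots,Kn-1$, the returned value is $\sum_{u=1}^n\sum_{k=1}^K x_u^k$ plus the sum of the noise values of the steps whose number is divisible by $n-1$. 2. The returned value is an unbiased estimate of $\bar x=\sum_{u=1}^n\sum_{k=1}^K x_u^k$ with standard deviation $\sqrt{\lceil Kn/(n-1)\rceil}\,\sigma_{loc}$. 3. For every $\delta'>0$, the protocol is $\bigl(\sqrt{2K\ln(1/\delta')}\,\varepsilon+K\varepsilon(e^{\varepsilon}-1),\ K\delta+\delta'\bigr)$-network DP (where the square root is read as $0$ if $\delta'>1$). -/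

import Mathlib

open MeasureTheory ProbabilityTheory

noncomputable section

/-- Finite lists over a measurable space, as the disjoint union over `N` of the product spaces
`Fin N → α`: a set of lists is measurable iff its trace on the lists of each length is. -/
instance List.instMeasurableSpaceOfFn {α : Type*} [MeasurableSpace α] :
    MeasurableSpace (List α) :=
  ⨅ N : ℕ, MeasurableSpace.map (fun f : Fin N → α => List.ofFn f) inferInstance

/-- A randomized mechanism `M`, with random seed drawn from the probability measure `P`, is
`(ε, δ)`-locally differentially private on the input space `α`. -/
def IsLDP {α Ω β : Type*} [MeasurableSpace Ω] [MeasurableSpace β]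
    (P : Measure Ω) [IsProbabilityMeasure P] (M : α → Ω → β) (ε δ : ℝ) : Prop :=
  ∀ x x' : α, ∀ S : Set β, MeasurableSet S →
    P.real {ω | M x ω ∈ S} ≤ Real.exp ε * P.real {ω | M x' ω ∈ S} + δ

/-- A transcript over the users `V`: the chronological list of all messages `(u, m, v)`
(user `u` sent a message with content `m` to user `v`). -/
abbrev Transcript (V M : Type*) := List (V × M × V)

/-- The view of user `v`: the messages that `v` sent or received. -/
def Transcript.obs {V M : Type*} [DecidableEq V] (v : V) (t : Transcript V M) :
    Transcript V M :=
  t.filter fun e => e.1 = v ∨ e.2.2 = v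

/-- Two datasets (one local dataset in `Data` per user) differ only on the data of user `u`. -/
def NeighborAt {V Data : Type*} (u : V) (D D' : V → Data) : Prop :=
  ∀ w : V, w ≠ u → D w = D' w

/-- `(ε, δ)`-network differential privacy of a decentralized algorithm `A`, which maps a dataset
and a random seed drawn from the probability measure `P` to the transcript of all messages. -/
def IsNetworkDP {V Data M Ω : Type*} [DecidableEq V] [MeasurableSpace V] [MeasurableSpace M]
    [MeasurableSpace Ω] (P : Measure Ω) [IsProbabilityMeasure P]
    (A : (V → Data) → Ω → Transcript V M) (ε δ : ℝ) : Prop :=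
  ∀ u v : V, u ≠ v → ∀ D D' : V → Data, NeighborAt u D D' →
    ∀ S : Set (Transcript V M), MeasurableSet S →
      P.real {ω | (A D ω).obs v ∈ S} ≤ Real.exp ε * P.real {ω | (A D' ω).obs v ∈ S} + δ

namespace RingSum

/-- Additive perturbation of a contribution `x` by a noise value `z`. -/
def perturb (x z : ℝ) : ℝ := x + z

/-- The successor of a user on the directed ring `0 → 1 → ⋯ → n - 1 → 0`. -/
def next {n : ℕ} (u : Fin n) : Fin n := ⟨(u.1 + 1) % n, Nat.mod_lt _ u.pos⟩

/-- The state of the protocol: the token `τ`, the counter `a`, and the messages sent so far. -/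
structure State (n : ℕ) where
  token : ℝ
  counter : ℕ
  log : Transcript (Fin n) ℝ

/-- The token and the counter of the protocol after the current user has added its contribution
`x`, where `z` is the value of the noise drawn by this user if `a = 0`. -/
def update (n : ℕ) (τ : ℝ) (a : ℕ) (x z : ℝ) : ℝ × ℕ :=
  if a = 0 then (τ + perturb x z, n - 2) else (τ + x, a - 1)

/-- User `u` in round `k` updates the token and sends it to the next user. -/
def step {K n : ℕ} (x : Fin n → Fin K → ℝ) (z : Fin K × Fin n → ℝ)
    (s : State n) (ku : Fin K × Fin n) : State n :=
  let r := update n s.token s.counter (x ku.2 ku.1) (z ku)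
  { token := r.1, counter := r.2, log := s.log ++ [(ku.2, r.1, next ku.2)] }

/-- The order of the steps: for `k` over the rounds, for `u` over the users. -/
def schedule (K n : ℕ) : List (Fin K × Fin n) := List.finRange K ×ˢ List.finRange n

/-- The run of the protocol, with contributions `x u k` and noise values `z (k, u)`. -/
def run {K n : ℕ} (x : Fin n → Fin K → ℝ) (z : Fin K × Fin n → ℝ) : State n :=
  (schedule K n).foldl (step x z) { token := 0, counter := 0, log := [] }

/-- The value returned by the protocol. -/
def output {K n : ℕ} (x : Fin n → Fin K → ℝ) (z : Fin K × Fin n → ℝ) : ℝ := (run x z).token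

/-- The transcript of the protocol on a dataset with contributions in `X`. -/
def transcript {K n : ℕ} {X : Set ℝ} (D : Fin n → Fin K → X) (z : Fin K × Fin n → ℝ) :
    Transcript (Fin n) ℝ :=
  (run (fun u k => (D u k : ℝ)) z).log

/-- The law of the noise values: independent, with common law `ν`. -/
abbrev noiseLaw (K n : ℕ) (ν : Measure ℝ) : Measure (Fin K × Fin n → ℝ) :=
  Measure.pi fun _ => ν

end RingSum

end

open MeasureTheory ProbabilityTheory

noncomputable section

open scoped ENNReal

/-! The counter forces noise exactly at the steps divisible by `n - 1`. This gives the formula for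
the output; mean and variance follow because the noise is centered and independent, and ⌈Kn/(n-1)⌉
steps are noisy.

For privacy, two consecutive steps of `v` are separated by `n - 1` steps, and any `n - 1`
consecutive steps contain exactly one noisy step. So a token seen by `v` contains the contribution
of `u` in a round if and only if it contains the noise of the corresponding block
(`noisyStep_le_iff`). Changing that contribution by `d` amounts, for `v`, to shifting one noise
value by `d`. Hence the view on `D` is the view on `D'` with at most `K` noise values translated
(`obs_log_run_add_noiseShift`), each by a difference of two admissible contributions; local privacy
makes the translated and original noise laws (ε, δ)-indistinguishable.

It remains to compare product measures with at most `K` different factors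
(`pi_real_le_of_indistinguishable`). At the cost of mass δ, each pair is trimmed to one with privacy
loss in [-ε, ε] whose normalised mean is at most ε(e^ε - 1). Hoeffding's lemma bounds the
exponential moments, these multiply over the factors, and a Chernoff choice of the order `t` yields
the constants. -/

/-! ### Privacy loss of one indistinguishable pair. -/

/-- The integral is the excess of P over cQ on {c q < p}, the worst test set for the hypothesis. -/
lemma integral_sub_min_le {α : Type*} [MeasurableSpace α] {μ P Q : Measure α}
    [IsFiniteMeasure P] [IsFiniteMeasure Q]
    {p q : α → ℝ} (hp : Measurable p) (hq : Measurable q) (hp0 : ∀ x, 0 ≤ p x)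
    (hq0 : ∀ x, 0 ≤ q x) (hpi : Integrable p μ) (hqi : Integrable q μ)
    (hP : P = μ.withDensity fun x => ENNReal.ofReal (p x))
    (hQ : Q = μ.withDensity fun x => ENNReal.ofReal (q x)) {c δ : ℝ}
    (h : ∀ S, MeasurableSet S → P.real S ≤ c * Q.real S + δ) :
    ∫ x, p x - min (p x) (c * q x) ∂μ ≤ δ := by
  have key : ∀ (f : α → ℝ) (S : Set α), (∀ x, 0 ≤ f x) → Measurable f → Integrable f μ →
      MeasurableSet S →
      (μ.withDensity fun x => ENNReal.ofReal (f x)).real S = ∫ x in S, f x ∂μ := by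
    intro f S hf hm hi hS
    rw [measureReal_def, withDensity_apply _ hS,
      integral_eq_lintegral_of_nonneg_ae (.of_forall hf) hm.aestronglyMeasurable]
  have hS : MeasurableSet {x | c * q x < p x} := measurableSet_lt (hq.const_mul c) hp
  have h1 := h _ hS
  rw [hP, hQ, key p _ hp0 hp hpi hS, key q _ hq0 hq hqi hS, ← integral_const_mul] at h1
  have h2 : ∫ x, p x - min (p x) (c * q x) ∂μ = ∫ x in {x | c * q x < p x}, (p x - c * q x) ∂μ := by
    rw [← integral_indicator hS]
    congr 1 with x
    by_cases hx : c * q x < p x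
    · rw [Set.indicator_of_mem (by exact hx), min_eq_right hx.le]
    · rw [Set.indicator_of_notMem (by exact hx), min_eq_left (not_lt.1 hx), sub_self]
  rw [h2, integral_sub hpi.integrableOn (hqi.integrableOn.const_mul c)]
  linarith

/-- Two probability measures that are `(ε, δ)`-indistinguishable are, up to a part of mass `δ`
of the first one, related by a bounded privacy loss `L`. -/
lemma exists_bounded_privacyLoss {α : Type*} [MeasurableSpace α] (P Q : Measure α)
    [IsProbabilityMeasure P] [IsProbabilityMeasure Q] {ε δ : ℝ} (hε : 0 ≤ ε)
    (hPQ : ∀ S, MeasurableSet S → P.real S ≤ Real.exp ε * Q.real S + δ)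
    (hQP : ∀ S, MeasurableSet S → Q.real S ≤ Real.exp ε * P.real S + δ) :
    ∃ (P₀ R : Measure α) (L : α → ℝ), P = P₀ + R ∧ R Set.univ ≤ ENNReal.ofReal δ ∧
      Measurable L ∧ (∀ x, |L x| ≤ ε) ∧
      P₀.withDensity (fun x => ENNReal.ofReal (Real.exp (-L x))) ≤ Q ∧
      P₀ Set.univ ≤ P₀.withDensity (fun x => ENNReal.ofReal (Real.exp (-L x))) Set.univ := by
  obtain ⟨μ, hμ, p, q, hpm, hqm, hp0, hq0, hpi, hqi, hP, hQ⟩ :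
      ∃ (μ : Measure α) (_ : IsFiniteMeasure μ) (p q : α → ℝ), Measurable p ∧ Measurable q ∧
        (∀ x, 0 ≤ p x) ∧ (∀ x, 0 ≤ q x) ∧ Integrable p μ ∧ Integrable q μ ∧
        P = μ.withDensity (fun x => ENNReal.ofReal (p x)) ∧
        Q = μ.withDensity (fun x => ENNReal.ofReal (q x)) := by
    have key : ∀ M : Measure α, IsProbabilityMeasure M → M ≪ P + Q →
        M = (P + Q).withDensity (fun x => ENNReal.ofReal (M.rnDeriv (P + Q) x).toReal) := by
      intro M _ hM
      conv_lhs => rw [← Measure.withDensity_rnDeriv_eq M (P + Q) hM]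
      refine withDensity_congr_ae ?_
      filter_upwards [M.rnDeriv_lt_top (P + Q)] with x hx
      rw [ENNReal.ofReal_toReal hx.ne]
    exact ⟨P + Q, inferInstance, fun x => (P.rnDeriv (P + Q) x).toReal,
      fun x => (Q.rnDeriv (P + Q) x).toReal, (P.measurable_rnDeriv _).ennreal_toReal,
      (Q.measurable_rnDeriv _).ennreal_toReal, fun _ => ENNReal.toReal_nonneg,
      fun _ => ENNReal.toReal_nonneg, Measure.integrable_toReal_rnDeriv,
      Measure.integrable_toReal_rnDeriv,
      key P inferInstance (Measure.absolutelyContinuous_of_le (Measure.le_add_right le_rfl)),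
      key Q inferInstance (Measure.absolutelyContinuous_of_le (Measure.le_add_left le_rfl))⟩
  have hone : ∀ (M : Measure α) (f : α → ℝ), IsProbabilityMeasure M → Measurable f →
      (∀ x, 0 ≤ f x) → M = μ.withDensity (fun x => ENNReal.ofReal (f x)) →
      ∫ x, f x ∂μ = 1 := by
    intro M f _ hm hf hM
    rw [integral_eq_lintegral_of_nonneg_ae (.of_forall hf) hm.aestronglyMeasurable,
      ← setLIntegral_univ, ← withDensity_apply _ MeasurableSet.univ, ← hM]
    simp
  have hp1 := hone P p inferInstance hpm hp0 hP
  have hq1 := hone Q q inferInstance hqm hq0 hQ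
  have he1 : 1 ≤ Real.exp ε := Real.one_le_exp hε
  set E := Real.exp ε with hE
  have hE0 : 0 < E := by positivity
  have hdp := integral_sub_min_le hpm hqm hp0 hq0 hpi hqi hP hQ hPQ
  have hdq := integral_sub_min_le hqm hpm hq0 hp0 hqi hpi hQ hP hQP
  -- Capping each density at e^ε times the other removes mass at most δ from each and bounds the
  -- ratio. The two remaining masses may differ, and the one kept from P must not exceed the one
  -- kept from Q, so `p₀` is lowered further towards `m`.
  set p₀ : α → ℝ := fun x => min (p x) (E * q x) with hp₀
  set q₀ : α → ℝ := fun x => min (q x) (E * p x) with hq₀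
  set m : α → ℝ := fun x => min (p₀ x) (q₀ x) with hm
  have hp₀m : Measurable p₀ := hpm.min (hqm.const_mul E)
  have hq₀m : Measurable q₀ := hqm.min (hpm.const_mul E)
  have hmm : Measurable m := hp₀m.min hq₀m
  have hp₀i : Integrable p₀ μ := hpi.inf (hqi.const_mul E)
  have hq₀i : Integrable q₀ μ := hqi.inf (hpi.const_mul E)
  have hmi : Integrable m μ := hp₀i.inf hq₀i
  have hp₀0 : ∀ x, 0 ≤ p₀ x := fun x => le_min (hp0 x) (mul_nonneg hE0.le (hq0 x))
  have hq₀0 : ∀ x, 0 ≤ q₀ x := fun x => le_min (hq0 x) (mul_nonneg hE0.le (hp0 x))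
  have hm0 : ∀ x, 0 ≤ m x := fun x => le_min (hp₀0 x) (hq₀0 x)
  rw [integral_sub hpi hp₀i, hp1] at hdp
  rw [integral_sub hqi hq₀i, hq1] at hdq
  have hca : ∫ x, m x ∂μ ≤ ∫ x, p₀ x ∂μ := integral_mono hmi hp₀i fun x => min_le_left _ _
  have hcb : ∫ x, m x ∂μ ≤ ∫ x, q₀ x ∂μ := integral_mono hmi hq₀i fun x => min_le_right _ _
  set a := ∫ x, p₀ x ∂μ
  set b := ∫ x, q₀ x ∂μ
  set c := ∫ x, m x ∂μ
  -- The weight `s` gives the interpolated density mass min(a, b), which is still at least 1 - δ.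
  obtain ⟨s, hs0, hs1, hsb, hsδ⟩ : ∃ s : ℝ, 0 ≤ s ∧ s ≤ 1 ∧ c + s * (a - c) ≤ b ∧
      1 - (c + s * (a - c)) ≤ δ := by
    rcases le_total a b with hab | hab
    · exact ⟨1, zero_le_one, le_rfl, by linarith, by linarith⟩
    · rcases hca.eq_or_lt with hac | hac
      · exact ⟨1, zero_le_one, le_rfl, by linarith, by linarith⟩
      · have hpos : 0 < a - c := sub_pos.2 hac
        have : (b - c) / (a - c) * (a - c) = b - c := div_mul_cancel₀ _ hpos.ne'
        exact ⟨(b - c) / (a - c), div_nonneg (by linarith) hpos.le,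
          (div_le_one hpos).2 (by linarith), by linarith, by linarith⟩
  set p₁ : α → ℝ := fun x => m x + s * (p₀ x - m x) with hp₁
  have hp₁m : Measurable p₁ := hmm.add ((hp₀m.sub hmm).const_mul s)
  have hp₁i : Integrable p₁ μ := hmi.add ((hp₀i.sub hmi).const_mul s)
  have hp₁int : ∫ x, p₁ x ∂μ = c + s * (a - c) := by
    have hd : Integrable (fun x => p₀ x - m x) μ := hp₀i.sub hmi
    rw [integral_add hmi (hd.const_mul s), integral_const_mul, integral_sub hp₀i hmi]
  have hmp₁ : ∀ x, m x ≤ p₁ x := fun x =>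
    le_add_of_nonneg_right (mul_nonneg hs0 (sub_nonneg.2 (min_le_left _ _)))
  have hp₁p₀ : ∀ x, p₁ x ≤ p₀ x := fun x => by
    have : m x ≤ p₀ x := min_le_left _ _
    simp only [hp₁]; nlinarith
  have hp₁0 : ∀ x, 0 ≤ p₁ x := fun x => (hm0 x).trans (hmp₁ x)
  have hp₁q₀ : ∀ x, p₁ x ≤ E * q₀ x := fun x => by
    refine (hp₁p₀ x).trans ?_
    simp only [hp₀, hq₀]
    rw [mul_min_of_nonneg _ _ hE0.le]
    refine le_min (min_le_right _ _) ((min_le_left _ _).trans ?_)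
    have := hp0 x
    have : p x ≤ E * p x := le_mul_of_one_le_left this he1
    exact this.trans (le_mul_of_one_le_left (by positivity) he1)
  have hq₀p₁ : ∀ x, q₀ x ≤ E * p₁ x := fun x => by
    refine le_trans ?_ (mul_le_mul_of_nonneg_left (hmp₁ x) hE0.le)
    simp only [hm]
    rw [mul_min_of_nonneg _ _ hE0.le]
    refine le_min ?_ (le_mul_of_one_le_left (hq₀0 x) he1)
    simp only [hp₀, hq₀]
    rw [mul_min_of_nonneg _ _ hE0.le]
    refine le_min (min_le_right _ _) ((min_le_left _ _).trans ?_)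
    have := hq0 x
    have : q x ≤ E * q x := le_mul_of_one_le_left this he1
    exact this.trans (le_mul_of_one_le_left (by positivity) he1)
  set L : α → ℝ := fun x => Real.log (p₁ x / q₀ x) with hL
  have hLm : Measurable L := (hp₁m.div hq₀m).log
  -- The two densities vanish together, and there `L` is log (0 / 0) = 0 by convention.
  have hpos : ∀ x, (p₁ x = 0 ∧ q₀ x = 0) ∨ (0 < p₁ x ∧ 0 < q₀ x) := fun x => by
    rcases (hp₁0 x).eq_or_lt with h | h
    · refine .inl ⟨h.symm, le_antisymm ?_ (hq₀0 x)⟩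
      simpa [← h] using hq₀p₁ x
    · exact .inr ⟨h, pos_of_mul_pos_right (h.trans_le (hp₁q₀ x)) hE0.le⟩
  have hLe : ∀ x, |L x| ≤ ε := fun x => by
    rcases hpos x with ⟨h1, h2⟩ | ⟨h1, h2⟩
    · simp [hL, h1, hε]
    · rw [abs_le]
      simp only [hL]
      constructor
      · rw [Real.le_log_iff_exp_le (div_pos h1 h2), Real.exp_neg, le_div_iff₀ h2,
          inv_mul_le_iff₀ (Real.exp_pos _)]
        exact hq₀p₁ x
      · rw [Real.log_le_iff_le_exp (div_pos h1 h2), div_le_iff₀ h2]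
        exact hp₁q₀ x
  have hdens : (μ.withDensity fun x => ENNReal.ofReal (p₁ x)).withDensity
      (fun x => ENNReal.ofReal (Real.exp (-L x))) =
      μ.withDensity fun x => ENNReal.ofReal (q₀ x) := by
    have hE' : Measurable fun x => ENNReal.ofReal (Real.exp (-L x)) := by fun_prop
    rw [← withDensity_mul _ hp₁m.ennreal_ofReal hE']
    congr 1 with x
    rw [Pi.mul_apply, ← ENNReal.ofReal_mul (hp₁0 x)]
    congr 1
    rcases hpos x with ⟨h1, h2⟩ | ⟨h1, h2⟩
    · rw [h1, h2, zero_mul]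
    · simp only [hL]
      rw [Real.exp_neg, Real.exp_log (div_pos h1 h2)]
      field_simp
  have hmass : ∀ f : α → ℝ, Integrable f μ → (∀ x, 0 ≤ f x) →
      μ.withDensity (fun x => ENNReal.ofReal (f x)) Set.univ = ENNReal.ofReal (∫ x, f x ∂μ) := by
    intro f hi hf
    rw [withDensity_apply _ MeasurableSet.univ, setLIntegral_univ,
      ofReal_integral_eq_lintegral_ofReal hi (.of_forall hf)]
  refine ⟨μ.withDensity fun x => ENNReal.ofReal (p₁ x),
    μ.withDensity fun x => ENNReal.ofReal (p x - p₁ x), L, ?_, ?_, hLm, hLe, ?_, ?_⟩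
  · rw [hP, ← withDensity_add_left hp₁m.ennreal_ofReal]
    congr 1 with x
    have h1 : p₁ x ≤ p x := (hp₁p₀ x).trans (min_le_left _ _)
    rw [Pi.add_apply, ← ENNReal.ofReal_add (hp₁0 x) (sub_nonneg.2 h1), add_sub_cancel]
  · rw [hmass (fun x => p x - p₁ x) (hpi.sub hp₁i)
      fun x => sub_nonneg.2 ((hp₁p₀ x).trans (min_le_left _ _))]
    refine ENNReal.ofReal_le_ofReal ?_
    rw [integral_sub hpi hp₁i, hp1, hp₁int]
    exact hsδ
  · rw [hdens, hQ]
    exact withDensity_mono (.of_forall fun x => ENNReal.ofReal_le_ofReal (min_le_left _ _))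
  · rw [hdens, hmass _ hp₁i hp₁0, hmass _ hq₀i hq₀0, hp₁int]
    exact ENNReal.ofReal_le_ofReal hsb

/-- From e^{-l}(1 + l) ≤ 1 one gets l ≤ 1 - e^{-l} + l(1 - e^{-l}), where the last term is the
integrand of the symmetrised Kullback–Leibler divergence. Integrated, the bound controls the mean
loss as soon as e^{-L} has mean at least 1. -/
lemma le_one_sub_exp_neg_add {ε l : ℝ} (hl : |l| ≤ ε) :
    l ≤ 1 - Real.exp (-l) + ε * (Real.exp ε - 1) := by
  have h1 : Real.exp (-l) * (1 + l) ≤ 1 := by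
    calc Real.exp (-l) * (1 + l) ≤ Real.exp (-l) * Real.exp l := by
          gcongr; linarith [Real.add_one_le_exp l]
      _ = 1 := by rw [← Real.exp_add]; simp
  have hb : Real.exp (-l) - 1 + l ≤ -l * (Real.exp (-l) - 1) := by linarith
  have hc : -l * (Real.exp (-l) - 1) ≤ ε * (Real.exp ε - 1) := by
    rcases abs_le.1 hl with ⟨h2, h3⟩
    rcases le_total 0 l with h | h
    · have h4 : 1 - Real.exp (-l) ≤ Real.exp ε - 1 := by
        have := Real.add_one_le_exp (-l)
        have := Real.add_one_le_exp ε
        linarith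
      have h5 : 0 ≤ 1 - Real.exp (-l) := by
        linarith [Real.exp_le_one_iff.2 (neg_nonpos.2 h)]
      calc -l * (Real.exp (-l) - 1) = l * (1 - Real.exp (-l)) := by ring
        _ ≤ ε * (Real.exp ε - 1) := mul_le_mul h3 h4 h5 (h.trans h3)
    · have h4 : Real.exp (-l) ≤ Real.exp ε := Real.exp_le_exp.2 (by linarith)
      have h5 : 1 ≤ Real.exp (-l) := Real.one_le_exp (by linarith)
      exact mul_le_mul (by linarith) (by linarith) (by linarith) (by linarith)
  linarith

/-- Chernoff-type bound on the exponential moments of a bounded privacy loss. -/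
lemma lintegral_exp_privacyLoss_le {α : Type*} [MeasurableSpace α] {P₀ : Measure α} {L : α → ℝ}
    {ε t : ℝ} (hLm : Measurable L) (hL : ∀ x, |L x| ≤ ε) (ht : 0 ≤ t)
    (h1 : P₀ Set.univ ≤ 1)
    (hmass : P₀ Set.univ ≤ P₀.withDensity (fun x => ENNReal.ofReal (Real.exp (-L x))) Set.univ) :
    ∫⁻ x, ENNReal.ofReal (Real.exp (t * L x)) ∂P₀ ≤
      ENNReal.ofReal (Real.exp (t * (ε * (Real.exp ε - 1)) + t ^ 2 * ε ^ 2 / 2)) := by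
  rcases eq_or_ne P₀ 0 with rfl | hne
  · simp
  have hu0 : P₀ Set.univ ≠ 0 := by simpa using hne
  have hut : P₀ Set.univ ≠ ∞ := (h1.trans_lt ENNReal.one_lt_top).ne
  set P := (P₀ Set.univ)⁻¹ • P₀ with hP
  have hprob : IsProbabilityMeasure P := ⟨by
    simp only [hP, Measure.smul_apply, smul_eq_mul]; exact ENNReal.inv_mul_cancel hu0 hut⟩
  have hlint : ∀ f : α → ℝ≥0∞, ∫⁻ x, f x ∂P = (P₀ Set.univ)⁻¹ * ∫⁻ x, f x ∂P₀ := fun f => by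
    rw [hP, lintegral_smul_measure, smul_eq_mul]
  -- Since `P₀` has mass at most 1, normalising it can only increase the integral.
  have hle : ∫⁻ x, ENNReal.ofReal (Real.exp (t * L x)) ∂P₀ ≤
      ∫⁻ x, ENNReal.ofReal (Real.exp (t * L x)) ∂P := by
    rw [hlint]
    exact le_mul_of_one_le_left (zero_le) (ENNReal.one_le_inv.2 h1)
  refine hle.trans ?_
  have hIcc : ∀ᵐ x ∂P, L x ∈ Set.Icc (-ε) ε := .of_forall fun x => abs_le.1 (hL x)
  have hLi : Integrable L P := Integrable.of_mem_Icc _ _ hLm.aemeasurable hIcc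
  have hexpi : ∀ s : ℝ, Integrable (fun x => Real.exp (s * L x)) P := fun s =>
    integrable_exp_mul_of_mem_Icc hLm.aemeasurable hIcc
  have hneg : Integrable (fun x => Real.exp (-L x)) P := by simpa using hexpi (-1)
  have hge : 1 ≤ ∫ x, Real.exp (-L x) ∂P := by
    rw [← ENNReal.ofReal_le_ofReal_iff (integral_nonneg fun _ => (Real.exp_pos _).le),
      ofReal_integral_eq_lintegral_ofReal hneg (.of_forall fun _ => (Real.exp_pos _).le), hlint,
      ENNReal.ofReal_one]
    rw [withDensity_apply _ MeasurableSet.univ, setLIntegral_univ] at hmass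
    calc (1 : ℝ≥0∞) = (P₀ Set.univ)⁻¹ * P₀ Set.univ := (ENNReal.inv_mul_cancel hu0 hut).symm
      _ ≤ _ := by gcongr
  have hmean : ∫ x, L x ∂P ≤ ε * (Real.exp ε - 1) := by
    have h2 : ∫ x, L x ∂P ≤ ∫ x, (1 - Real.exp (-L x) + ε * (Real.exp ε - 1)) ∂P :=
      integral_mono hLi (((integrable_const _).sub hneg).add (integrable_const _))
        fun x => le_one_sub_exp_neg_add (hL x)
    have h3 : ∫ x, (1 - Real.exp (-L x) + ε * (Real.exp ε - 1)) ∂P =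
        1 - ∫ x, Real.exp (-L x) ∂P + ε * (Real.exp ε - 1) := by
      have hi : Integrable (fun x => 1 - Real.exp (-L x)) P := (integrable_const _).sub hneg
      rw [integral_add hi (integrable_const _), integral_sub (integrable_const _) hneg]
      simp
    linarith
  -- Hoeffding's lemma on an interval of length 2ε: variance proxy ε².
  have hmgf := (hasSubgaussianMGF_of_mem_Icc hLm.aemeasurable hIcc).mgf_le t
  rw [mgf] at hmgf
  have hc : (((‖ε - -ε‖₊ / 2) ^ 2 : NNReal) : ℝ) = ε ^ 2 := by
    push_cast
    rw [Real.norm_eq_abs, div_pow, sq_abs]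
    ring
  rw [hc] at hmgf
  rw [← ofReal_integral_eq_lintegral_ofReal (hexpi t) (.of_forall fun _ => (Real.exp_pos _).le)]
  refine ENNReal.ofReal_le_ofReal ?_
  set m := ∫ x, L x ∂P
  have h4 : ∫ x, Real.exp (t * L x) ∂P = Real.exp (t * m) * ∫ x, Real.exp (t * (L x - m)) ∂P := by
    rw [← integral_const_mul]
    congr 1 with x
    rw [← Real.exp_add]
    ring_nf
  rw [h4, Real.exp_add]
  refine mul_le_mul ?_ (hmgf.trans (le_of_eq (by ring_nf)))
    (integral_nonneg fun _ => (Real.exp_pos _).le) (Real.exp_pos _).le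
  exact Real.exp_le_exp.2 (mul_le_mul_of_nonneg_left hmean ht)

/-! ### Advanced composition for product measures. -/

/-- Up to a part of mass `d`, the measure `P` has a privacy loss with respect to `Q` whose
exponential moment of order `t` is at most `A`. -/
def HasPrivacyLoss {α : Type*} [MeasurableSpace α] (t : ℝ) (P Q : Measure α) (A d : ℝ≥0∞) : Prop :=
  ∃ (P₀ R : Measure α) (L : α → ℝ), P = P₀ + R ∧ R Set.univ ≤ d ∧ Measurable L ∧
    P₀.withDensity (fun x => ENNReal.ofReal (Real.exp (-L x))) ≤ Q ∧
    ∫⁻ x, ENNReal.ofReal (Real.exp (t * L x)) ∂P₀ ≤ A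

lemma HasPrivacyLoss.refl {α : Type*} [MeasurableSpace α] (t : ℝ) (P : Measure α)
    [IsProbabilityMeasure P] : HasPrivacyLoss t P P 1 0 :=
  ⟨P, 0, fun _ => 0, by simp, by simp, measurable_const, by simp, by simp⟩

lemma HasPrivacyLoss.of_indistinguishable {α : Type*} [MeasurableSpace α] {P Q : Measure α}
    [IsProbabilityMeasure P] [IsProbabilityMeasure Q] {ε δ t : ℝ} (hε : 0 ≤ ε) (ht : 0 ≤ t)
    (hPQ : ∀ S, MeasurableSet S → P.real S ≤ Real.exp ε * Q.real S + δ)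
    (hQP : ∀ S, MeasurableSet S → Q.real S ≤ Real.exp ε * P.real S + δ) :
    HasPrivacyLoss t P Q
      (ENNReal.ofReal (Real.exp (t * (ε * (Real.exp ε - 1)) + t ^ 2 * ε ^ 2 / 2)))
      (ENNReal.ofReal δ) := by
  obtain ⟨P₀, R, L, hP, hR, hLm, hL, hQ, hmass⟩ := exists_bounded_privacyLoss P Q hε hPQ hQP
  refine ⟨P₀, R, L, hP, hR, hLm, hQ, lintegral_exp_privacyLoss_le hLm hL ht ?_ hmass⟩
  rw [← measure_univ (μ := P), hP]
  exact Measure.le_add_right le_rfl _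

/-- A polynomial bound of order `t` on the excess of `M` over all multiples of `N`, up to `κ`. -/
def HasExcessBound {α : Type*} [MeasurableSpace α] (t : ℝ) (M N : Measure α) (B κ : ℝ≥0∞) : Prop :=
  ∀ S, MeasurableSet S → ∀ c : ℝ, 0 < c →
    M S ≤ ENNReal.ofReal c * N S + B * ENNReal.ofReal (c ^ (-t)) + κ

lemma HasExcessBound.refl {α : Type*} [MeasurableSpace α] {t : ℝ} (ht : 0 ≤ t) (M : Measure α)
    [IsProbabilityMeasure M] : HasExcessBound t M M 1 0 := by
  intro S _ c hc
  rw [one_mul, add_zero]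
  rcases le_total 1 c with h | h
  · exact (le_mul_of_one_le_left zero_le (ENNReal.one_le_ofReal.2 h)).trans le_self_add
  · exact prob_le_one.trans (le_add_left (ENNReal.one_le_ofReal.2
      (Real.one_le_rpow_of_pos_of_le_one_of_nonpos hc h (neg_nonpos.2 ht))))

lemma HasExcessBound.map {α β : Type*} [MeasurableSpace α] [MeasurableSpace β] {t : ℝ}
    {M N : Measure α} {B κ : ℝ≥0∞} (h : HasExcessBound t M N B κ) {f : α → β}
    (hf : Measurable f) : HasExcessBound t (M.map f) (N.map f) B κ := by
  intro S hS c hc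
  rw [Measure.map_apply hf hS, Measure.map_apply hf hS]
  exact h _ (hf hS) c hc

/-- Freeze the first coordinate x and apply the bound for (M, N) at the threshold c e^{-L x}. The
factor e^{-L} turns `P₀` into a part of `Q`, while (c e^{-L})^{-t} = c^{-t} e^{tL} integrates to at
most c^{-t} A. The quantifier over all c in `HasExcessBound` is what permits this x-dependent
threshold. -/
lemma HasPrivacyLoss.prod {α β : Type*} [MeasurableSpace α] [MeasurableSpace β] {t : ℝ}
    {P Q : Measure α} {M N : Measure β} [IsProbabilityMeasure P] [SFinite Q]
    [IsProbabilityMeasure M] [SFinite N] {A B d κ : ℝ≥0∞} (h : HasPrivacyLoss t P Q A d)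
    (hMN : HasExcessBound t M N B κ) :
    HasExcessBound t (P.prod M) (Q.prod N) (A * B) (d + κ) := by
  obtain ⟨P₀, ρ, L, hP, hR, hLm, hQ, hA⟩ := h
  intro S hS c hc
  have hP₀ : P₀ Set.univ ≤ 1 := by
    rw [← measure_univ (μ := P), hP]
    exact Measure.le_add_right le_rfl _
  have hEm : Measurable fun x => ENNReal.ofReal (Real.exp (-L x)) := by fun_prop
  have hEt : Measurable fun x => ENNReal.ofReal (Real.exp (t * L x)) := by fun_prop
  have hNm : Measurable fun x => N (Prod.mk x ⁻¹' S) := measurable_measure_prodMk_left hS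
  have hRle : ∫⁻ x, M (Prod.mk x ⁻¹' S) ∂ρ ≤ d := by
    refine (lintegral_mono (g := fun _ => 1) fun x => prob_le_one).trans ?_
    simpa using hR
  have hpt : ∀ x, M (Prod.mk x ⁻¹' S) ≤
      ENNReal.ofReal c * (ENNReal.ofReal (Real.exp (-L x)) * N (Prod.mk x ⁻¹' S)) +
        B * ENNReal.ofReal (c ^ (-t)) * ENNReal.ofReal (Real.exp (t * L x)) + κ := fun x => by
    refine (hMN _ (measurable_prodMk_left hS) (c * Real.exp (-L x)) (by positivity)).trans
      (le_of_eq ?_)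
    rw [ENNReal.ofReal_mul hc.le, Real.mul_rpow hc.le (Real.exp_pos _).le, ← Real.exp_mul,
      ENNReal.ofReal_mul (by positivity), neg_mul_neg, mul_comm (L x) t]
    simp only [mul_assoc]
  have hQle : ∫⁻ x, ENNReal.ofReal (Real.exp (-L x)) * N (Prod.mk x ⁻¹' S) ∂P₀ ≤
      ∫⁻ x, N (Prod.mk x ⁻¹' S) ∂Q := by
    calc _ = ∫⁻ x, N (Prod.mk x ⁻¹' S) ∂(P₀.withDensity _) :=
          (lintegral_withDensity_eq_lintegral_mul _ hEm hNm).symm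
      _ ≤ _ := lintegral_mono' hQ le_rfl
  have hP₀le : ∫⁻ x, M (Prod.mk x ⁻¹' S) ∂P₀ ≤ ENNReal.ofReal c * (Q.prod N) S +
      B * ENNReal.ofReal (c ^ (-t)) * A + κ := by
    refine (lintegral_mono hpt).trans ?_
    rw [lintegral_add_right _ measurable_const, lintegral_add_right _ (hEt.const_mul _),
      lintegral_const_mul _ (by exact hEm.mul hNm), lintegral_const_mul _ hEt, lintegral_const,
      Measure.prod_apply hS]
    refine add_le_add (add_le_add ?_ ?_) (mul_le_of_le_one_right' hP₀)
    · gcongr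
    · gcongr
  rw [Measure.prod_apply hS]
  conv_lhs => rw [hP, lintegral_add_measure]
  calc _ ≤ _ := add_le_add hP₀le hRle
    _ = _ := by ring

lemma HasExcessBound.pi_fin {α : Type*} [MeasurableSpace α] {t : ℝ} (ht : 0 ≤ t) {N : ℕ}
    (P Q : Fin N → Measure α) [∀ i, IsProbabilityMeasure (P i)] [∀ i, IsProbabilityMeasure (Q i)]
    (A d : Fin N → ℝ≥0∞) (h : ∀ i, HasPrivacyLoss t (P i) (Q i) (A i) (d i)) :
    HasExcessBound t (Measure.pi P) (Measure.pi Q) (∏ i, A i) (∑ i, d i) := by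
  induction N with
  | zero =>
    have : P = Q := Subsingleton.elim _ _
    subst this
    simpa using HasExcessBound.refl ht (Measure.pi P)
  | succ N ih =>
    have h1 := (h 0).prod (ih (fun i => P i.succ) (fun i => Q i.succ) (fun i => A i.succ)
      (fun i => d i.succ) fun i => h i.succ)
    have h2 := h1.map (MeasurableEquiv.piFinSuccAbove (fun _ => α) 0).symm.measurable
    rw [Fin.prod_univ_succ, Fin.sum_univ_succ]
    have h3 := (measurePreserving_piFinSuccAbove P 0).symm.map_eq
    have h4 := (measurePreserving_piFinSuccAbove Q 0).symm.map_eq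
    simp only [Fin.zero_succAbove] at h3 h4
    rwa [h3, h4] at h2

lemma HasExcessBound.pi {ι α : Type*} [Fintype ι] [MeasurableSpace α] {t : ℝ} (ht : 0 ≤ t)
    (P Q : ι → Measure α) [∀ i, IsProbabilityMeasure (P i)] [∀ i, IsProbabilityMeasure (Q i)]
    (A d : ι → ℝ≥0∞) (h : ∀ i, HasPrivacyLoss t (P i) (Q i) (A i) (d i)) :
    HasExcessBound t (Measure.pi P) (Measure.pi Q) (∏ i, A i) (∑ i, d i) := by
  let e := (Fintype.equivFin ι).symm
  have h1 := HasExcessBound.pi_fin ht (fun i => P (e i)) (fun i => Q (e i)) (fun i => A (e i))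
    (fun i => d (e i)) fun i => h (e i)
  have h2 := h1.map (MeasurableEquiv.piCongrLeft (fun _ => α) e).measurable
  rw [Measure.pi_map_piCongrLeft e P, Measure.pi_map_piCongrLeft e Q] at h2
  rwa [e.prod_comp A, e.sum_comp d] at h2

/-- Advanced composition for products of pairwise indistinguishable probability measures, of which
at most `K` pairs differ. -/
lemma pi_real_le_of_indistinguishable {ι α : Type*} [Fintype ι] [MeasurableSpace α]
    (P Q : ι → Measure α) [∀ i, IsProbabilityMeasure (P i)] [∀ i, IsProbabilityMeasure (Q i)]
    {ε δ δ' : ℝ} (hε : 0 < ε) (hδ : 0 ≤ δ) (hδ' : 0 < δ') (J : Finset ι) {K : ℕ} (hJ : J.card ≤ K)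
    (hPQ : ∀ i ∈ J, ∀ S, MeasurableSet S → (P i).real S ≤ Real.exp ε * (Q i).real S + δ)
    (hQP : ∀ i ∈ J, ∀ S, MeasurableSet S → (Q i).real S ≤ Real.exp ε * (P i).real S + δ)
    (heq : ∀ i ∉ J, P i = Q i) {S : Set (ι → α)} (hS : MeasurableSet S) :
    (Measure.pi P).real S ≤
      Real.exp (√(2 * K * Real.log (1 / δ')) * ε + K * ε * (Real.exp ε - 1)) *
        (Measure.pi Q).real S + (K * δ + δ') := by
  classical
  rcases le_or_gt 1 δ' with h1 | h1
  · have : (Measure.pi P).real S ≤ 1 := measureReal_le_one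
    have h2 : 0 ≤ Real.exp (√(2 * K * Real.log (1 / δ')) * ε + K * ε * (Real.exp ε - 1)) *
        (Measure.pi Q).real S := by positivity
    have h3 : 0 ≤ K * δ := by positivity
    linarith
  rcases Nat.eq_zero_or_pos K with rfl | hK
  · have : P = Q := funext fun i => heq i (by simp [Finset.card_eq_zero.1 (Nat.le_zero.1 hJ)])
    subst this
    simp [hδ'.le]
  have hK' : (0 : ℝ) < K := Nat.cast_pos.2 hK
  set l := Real.log (1 / δ') with hl
  have hl0 : 0 < l := Real.log_pos (one_lt_one_div hδ' h1)
  set r := √(2 * K * l) with hr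
  have hr2 : r ^ 2 = 2 * K * l := Real.sq_sqrt (by positivity)
  -- The minimiser of K t² ε² / 2 - t r ε, with minimum -r² / (2K) = -l = log δ'.
  set t := r / (K * ε) with ht
  have ht0 : 0 ≤ t := by positivity
  set m := ε * (Real.exp ε - 1) with hm
  have hm0 : 0 ≤ m := mul_nonneg hε.le (sub_nonneg.2 (Real.one_le_exp hε.le))
  set a := t * m + t ^ 2 * ε ^ 2 / 2 with ha
  have ha0 : 0 ≤ a := by positivity
  have hloss : ∀ i, HasPrivacyLoss t (P i) (Q i)
      (if i ∈ J then ENNReal.ofReal (Real.exp a) else 1) (if i ∈ J then ENNReal.ofReal δ else 0) := by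
    intro i
    split_ifs with hi
    · exact .of_indistinguishable hε.le ht0 (hPQ i hi) (hQP i hi)
    · rw [heq i hi]; exact .refl t _
  -- With c the target multiplicative factor, the term B c^{-t} becomes at most δ'.
  have key := HasExcessBound.pi ht0 P Q _ _ hloss S hS
    (Real.exp (r * ε + K * ε * (Real.exp ε - 1))) (Real.exp_pos _)
  simp only [Finset.prod_ite_mem, Finset.univ_inter, Finset.prod_const, Finset.sum_ite_mem,
    Finset.sum_const, ← ENNReal.ofReal_pow (Real.exp_pos _).le, ← Real.exp_nat_mul,
    ← Real.exp_mul, ← ENNReal.ofReal_mul (Real.exp_pos _).le, ← Real.exp_add, nsmul_eq_mul] at key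
  have hδ'exp : Real.exp (J.card * a + (r * ε + K * ε * (Real.exp ε - 1)) * -t) ≤ δ' := by
    rw [← Real.le_log_iff_exp_le hδ']
    have h2 : (J.card : ℝ) * a ≤ K * a := by gcongr
    have h3 : t * (K * ε) = r := div_mul_cancel₀ _ (by positivity)
    have h4 : K * a + (r * ε + K * ε * (Real.exp ε - 1)) * -t = -l := by
      have h5 : K * (t ^ 2 * ε ^ 2) = 2 * l := by
        have : K * (K * (t ^ 2 * ε ^ 2)) = K * (2 * l) := by
          calc _ = (t * (K * ε)) ^ 2 := by ring
            _ = _ := by rw [h3, hr2]; ring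
        exact mul_left_cancel₀ hK'.ne' this
      have h6 : r * ε * t = 2 * l := by rw [← h3, ← h5]; ring
      rw [ha, hm]
      linear_combination h5 / 2 - h6
    have h7 : -l = Real.log δ' := by rw [hl, one_div, Real.log_inv, neg_neg]
    linarith
  have hfin := key.trans (add_le_add (add_le_add le_rfl (ENNReal.ofReal_le_ofReal hδ'exp))
    (mul_le_mul_left (Nat.cast_le.2 hJ) _))
  rw [measureReal_def, measureReal_def, ← ENNReal.ofReal_le_ofReal_iff (by positivity),
    ENNReal.ofReal_toReal (measure_ne_top _ _)]
  refine hfin.trans (le_of_eq ?_)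
  rw [ENNReal.ofReal_add (by positivity) (by positivity), ENNReal.ofReal_mul (Real.exp_pos _).le,
    ENNReal.ofReal_toReal (measure_ne_top _ _), ENNReal.ofReal_add (by positivity) hδ'.le,
    ENNReal.ofReal_mul hK'.le, ENNReal.ofReal_natCast]
  ring

/-- The length of the list does not depend on `ω`, so the map factors through `List.ofFn` for a
single length. -/
lemma List.measurable_map_of_measurable {α Ω ι : Type*} [MeasurableSpace α] [MeasurableSpace Ω]
    (l : List ι) {g : ι → Ω → α} (hg : ∀ i, Measurable (g i)) :
    Measurable fun ω => l.map fun i => g i ω := by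
  have h1 : Measurable fun ω => fun i : Fin l.length => g (l.get i) ω :=
    measurable_pi_iff.2 fun i => hg _
  have h2 : Measurable fun f : Fin l.length → α => List.ofFn f :=
    Measurable.of_le_map (iInf_le _ l.length)
  have h3 : (fun ω => l.map fun i => g i ω) =
      (fun f : Fin l.length → α => List.ofFn f) ∘ fun ω => fun i => g (l.get i) ω := by
    ext1 ω
    exact (List.ofFn_getElem_eq_map l fun i => g i ω).symm
  rw [h3]
  exact h2.comp h1

/-! ### Closed form of the run. -/

namespace RingSum

variable {K n : ℕ}

/-- The number of the step of a user in a round. -/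
def stepNum (p : Fin K × Fin n) : ℕ := p.1 * n + p.2

lemma stepNum_injective : Function.Injective (stepNum : Fin K × Fin n → ℕ) := by
  intro p q h
  have hpq : finProdFinEquiv p = finProdFinEquiv q := by
    ext
    simp only [stepNum] at h
    simp only [finProdFinEquiv_apply_val]
    linarith
  exact finProdFinEquiv.injective hpq

lemma exists_stepNum_eq {s : ℕ} (hs : s < K * n) : ∃ p : Fin K × Fin n, stepNum p = s := by
  refine ⟨finProdFinEquiv.symm ⟨s, hs⟩, ?_⟩
  have h := congrArg Fin.val (finProdFinEquiv.apply_symm_apply (⟨s, hs⟩ : Fin (K * n)))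
  rw [finProdFinEquiv_apply_val] at h
  simp only [stepNum]
  linarith

lemma stepNum_lt (p : Fin K × Fin n) : stepNum p < K * n := by
  have h := (finProdFinEquiv p).isLt
  rw [finProdFinEquiv_apply_val] at h
  simp only [stepNum]
  linarith

lemma sum_range_eq_sum_stepNum (F : ℕ → ℝ) :
    ∑ s ∈ Finset.range (K * n), F s = ∑ p : Fin K × Fin n, F (stepNum p) := by
  rw [Finset.sum_range, ← finProdFinEquiv.sum_comp]
  refine Finset.sum_congr rfl fun p _ => ?_
  rw [finProdFinEquiv_apply_val, stepNum]
  congr 1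
  ring

/-- The schedule runs in the order of the step numbers, so the protocol can be analysed by induction
on time. -/
lemma schedule_map_stepNum : (schedule K n).map stepNum = List.range (K * n) := by
  induction K with
  | zero => simp [schedule]
  | succ K ih =>
    rw [Nat.succ_mul, List.range_add, ← ih]
    have h : ∀ K, schedule K n =
        (List.finRange K).flatMap fun k => (List.finRange n).map (Prod.mk k) := fun _ => rfl
    rw [h, h, List.finRange_succ_last, List.flatMap_append, List.flatMap_map, List.map_append,
      List.map_flatMap, List.map_flatMap, List.flatMap_singleton, List.map_map,
      ← List.map_coe_finRange_eq_range, List.map_map]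
    simp [stepNum, Function.comp_def, List.map_flatMap]

/-- The values of a family of reals indexed by the steps, as a function of the step number. -/
def byNum (f : Fin K × Fin n → ℝ) : ℕ → ℝ := Function.extend stepNum f 0

lemma byNum_stepNum (f : Fin K × Fin n → ℝ) (p : Fin K × Fin n) : byNum f (stepNum p) = f p :=
  stepNum_injective.extend_apply f 0 p

/-- The sum of the contributions and of the injected noise values over the first `t` steps. -/
def partialSum (n : ℕ) (x z : ℕ → ℝ) (t : ℕ) : ℝ :=
  ∑ s ∈ Finset.range t, (x s + if (n - 1) ∣ s then z s else 0)

/-- The user active in a step. -/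
def userAt (hn : 2 ≤ n) (s : ℕ) : Fin n := ⟨s % n, Nat.mod_lt _ (by omega)⟩

lemma userAt_stepNum (hn : 2 ≤ n) (p : Fin K × Fin n) : userAt hn (stepNum p) = p.2 := by
  ext
  simp [userAt, stepNum, Nat.mod_eq_of_lt p.2.isLt]

/-- A step of the protocol, in terms of its number. -/
def numStep (hn : 2 ≤ n) (x z : ℕ → ℝ) (st : State n) (s : ℕ) : State n :=
  let r := update n st.token st.counter (x s) (z s)
  { token := r.1, counter := r.2, log := st.log ++ [(userAt hn s, r.1, next (userAt hn s))] }

/-- The counter is the waiting time to the next multiple of `n - 1`: the invariant makes it the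
number below `n - 1` that completes `t` to such a multiple, so it is zero exactly when `n - 1`
divides `t`. -/
lemma foldl_numStep (hn : 2 ≤ n) (x z : ℕ → ℝ) (t : ℕ) :
    let st := (List.range t).foldl (numStep hn x z) { token := 0, counter := 0, log := [] }
    st.token = partialSum n x z t ∧ st.counter < n - 1 ∧ (n - 1) ∣ t + st.counter ∧
      st.log = (List.range t).map fun s =>
        (userAt hn s, partialSum n x z (s + 1), next (userAt hn s)) := by
  induction t with
  | zero => simp [partialSum]; omega
  | succ t ih =>
    simp only [List.range_succ, List.foldl_append, List.foldl_cons, List.foldl_nil,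
      List.map_append, List.map_cons, List.map_nil]
    set st := (List.range t).foldl (numStep hn x z) { token := 0, counter := 0, log := [] }
    obtain ⟨h1, h2, h3, h4⟩ := ih
    have hs : partialSum n x z (t + 1) =
        partialSum n x z t + (x t + if (n - 1) ∣ t then z t else 0) := Finset.sum_range_succ _ _
    by_cases ha : st.counter = 0
    · have hd : (n - 1) ∣ t := by simpa [ha] using h3
      have htok : (numStep hn x z st t).token = partialSum n x z (t + 1) := by
        simp [numStep, update, ha, perturb, hs, hd, h1]
      refine ⟨htok, ?_, ?_, ?_⟩
      · simp [numStep, update, ha]; omega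
      · have : t + 1 + (n - 2) = t + (n - 1) := by omega
        simpa [numStep, update, ha, this] using hd
      · rw [← htok, ← h4]; rfl
    · have hd : ¬ (n - 1) ∣ t := fun hd =>
        ha (Nat.eq_zero_of_dvd_of_lt ((Nat.dvd_add_right hd).1 h3) h2)
      have htok : (numStep hn x z st t).token = partialSum n x z (t + 1) := by
        simp [numStep, update, ha, hs, hd, h1]
      refine ⟨htok, ?_, ?_, ?_⟩
      · simp [numStep, update, ha]; omega
      · have : t + 1 + (st.counter - 1) = t + st.counter := by omega
        simpa [numStep, update, ha, this] using h3
      · rw [← htok, ← h4]; rfl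

lemma run_eq_foldl_numStep (hn : 2 ≤ n) (x : Fin n → Fin K → ℝ) (z : Fin K × Fin n → ℝ) :
    run x z = (List.range (K * n)).foldl (numStep hn (byNum fun p => x p.2 p.1) (byNum z))
      { token := 0, counter := 0, log := [] } := by
  rw [← schedule_map_stepNum, List.foldl_map, run]
  congr 1
  ext1 st
  ext1 p
  simp only [step, numStep, byNum_stepNum, userAt_stepNum]

lemma output_eq_partialSum (hn : 2 ≤ n) (x : Fin n → Fin K → ℝ) (z : Fin K × Fin n → ℝ) :
    output x z = partialSum n (byNum fun p => x p.2 p.1) (byNum z) (K * n) := by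
  rw [output, run_eq_foldl_numStep hn]
  exact (foldl_numStep hn _ _ _).1

lemma log_run (hn : 2 ≤ n) (x : Fin n → Fin K → ℝ) (z : Fin K × Fin n → ℝ) :
    (run x z).log = (List.range (K * n)).map fun s =>
      (userAt hn s, partialSum n (byNum fun p => x p.2 p.1) (byNum z) (s + 1),
        next (userAt hn s)) := by
  rw [run_eq_foldl_numStep hn]
  exact (foldl_numStep hn _ _ _).2.2.2

/-- The numbers of the steps whose message is sent or received by `v`. -/
def observed (hn : 2 ≤ n) (K : ℕ) (v : Fin n) : List ℕ :=
  (List.range (K * n)).filter fun s => userAt hn s = v ∨ next (userAt hn s) = v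

lemma obs_log_run (hn : 2 ≤ n) (v : Fin n) (x : Fin n → Fin K → ℝ) (z : Fin K × Fin n → ℝ) :
    (run x z).log.obs v = (observed hn K v).map fun s =>
      (userAt hn s, partialSum n (byNum fun p => x p.2 p.1) (byNum z) (s + 1),
        next (userAt hn s)) := by
  rw [log_run hn, Transcript.obs, List.filter_map]
  rfl

/-- The returned value: the sum of all contributions plus the noise of the steps whose number is
divisible by `n - 1`. -/
lemma output_eq (hn : 2 ≤ n) (x : Fin n → Fin K → ℝ) (z : Fin K × Fin n → ℝ) :
    output x z = (∑ u, ∑ k, x u k) +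
      ∑ p : Fin K × Fin n, if (n - 1) ∣ stepNum p then z p else 0 := by
  rw [output_eq_partialSum hn, partialSum, sum_range_eq_sum_stepNum]
  simp only [byNum_stepNum]
  rw [Finset.sum_add_distrib, Fintype.sum_prod_type_right]

lemma measurable_byNum (s : ℕ) : Measurable fun z : Fin K × Fin n → ℝ => byNum z s := by
  by_cases hs : s < K * n
  · obtain ⟨p, rfl⟩ := exists_stepNum_eq hs
    simpa only [byNum_stepNum] using measurable_pi_apply p
  · have : ∀ z : Fin K × Fin n → ℝ, byNum z s = 0 := fun z =>
      Function.extend_apply' _ _ _ fun ⟨p, hp⟩ => hs (hp ▸ stepNum_lt p)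
    simpa only [this] using measurable_const

lemma measurable_obs_log_run (hn : 2 ≤ n) (v : Fin n) (x : Fin n → Fin K → ℝ) :
    Measurable fun z : Fin K × Fin n → ℝ => (run x z).log.obs v := by
  simp only [obs_log_run hn]
  refine List.measurable_map_of_measurable _ fun s => ?_
  refine measurable_const.prodMk (Measurable.prodMk ?_ measurable_const)
  unfold partialSum
  refine Finset.measurable_sum _ fun r _ => measurable_const.add ?_
  split_ifs
  · exact measurable_byNum r
  · exact measurable_const


/-! ### Mean and variance of the output. -/

/-- Step 0 is counted, hence a ceiling and not a floor. -/
lemma card_filter_dvd_range (r N : ℕ) (hr : 0 < r) :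
    ((Finset.range N).filter fun s => r ∣ s).card = ⌈(N : ℝ) / r⌉₊ := by
  have h := Nat.count_modEq_card_eq_ceil N hr 0
  rw [Nat.count_eq_card_filter_range] at h
  simp only [Nat.modEq_zero_iff_dvd, Nat.zero_mod, Nat.cast_zero, sub_zero] at h
  have h2 : (⌈(N : ℝ) / r⌉ : ℤ) = ⌈(N : ℚ) / r⌉ := by
    rw [← Rat.ceil_cast (α := ℝ)]
    push_cast
    rfl
  have h3 : (0 : ℝ) ≤ (N : ℝ) / r := by positivity
  have h4 := Int.natCast_ceil_eq_ceil h3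
  exact Int.ofNat_inj.1 (h.trans (h2.symm.trans h4.symm))

section Noise
variable {ν : Measure ℝ} [IsProbabilityMeasure ν]

lemma memLp_ite_eval (hν : MemLp id 2 ν) (p : Fin K × Fin n) (c : Prop) [Decidable c] :
    MemLp (fun z : Fin K × Fin n → ℝ => if c then z p else 0) 2 (noiseLaw K n ν) := by
  split_ifs
  · exact hν.comp_measurePreserving (measurePreserving_eval (fun _ => ν) p)
  · exact MemLp.zero

lemma memLp_output (hn : 2 ≤ n) (hν : MemLp id 2 ν) (x : Fin n → Fin K → ℝ) :
    MemLp (output x) 2 (noiseLaw K n ν) := by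
  rw [funext (output_eq hn x)]
  have h : MemLp (fun z : Fin K × Fin n → ℝ =>
      ∑ p : Fin K × Fin n, if (n - 1) ∣ stepNum p then z p else 0) 2 (noiseLaw K n ν) :=
    memLp_finsetSum _ fun p _ => memLp_ite_eval hν p _
  have hc : MemLp (fun _ : Fin K × Fin n → ℝ => ∑ u, ∑ k, x u k) 2 (noiseLaw K n ν) :=
    memLp_const _
  exact hc.add h

lemma integral_output (hn : 2 ≤ n) (hν : MemLp id 2 ν) (hmean : ∫ z, z ∂ν = 0)
    (x : Fin n → Fin K → ℝ) :
    ∫ z, output x z ∂(noiseLaw K n ν) = ∑ u, ∑ k, x u k := by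
  have hi : ∀ p : Fin K × Fin n, Integrable (fun z : Fin K × Fin n → ℝ =>
      if (n - 1) ∣ stepNum p then z p else 0) (noiseLaw K n ν) := fun p =>
    (memLp_ite_eval hν p _).integrable one_le_two
  simp only [output_eq hn]
  rw [integral_add (integrable_const _) (integrable_finsetSum _ fun p _ => hi p),
    integral_finsetSum _ fun p _ => hi p, integral_const, probReal_univ, one_smul,
    add_eq_left]
  refine Finset.sum_eq_zero fun p _ => ?_
  split_ifs
  · have := integral_comp_eval (μ := fun _ : Fin K × Fin n => ν) (i := p)
      (f := fun z : ℝ => z) hν.aestronglyMeasurable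
    rw [this, hmean]
  · simp

lemma variance_output (hn : 2 ≤ n) (hν : MemLp id 2 ν) (x : Fin n → Fin K → ℝ) :
    variance (output x) (noiseLaw K n ν) =
      ⌈((K : ℝ) * n) / ((n : ℝ) - 1)⌉₊ * variance id ν := by
  have h1 : output x = fun z => (∑ u, ∑ k, x u k) +
      (∑ p : Fin K × Fin n, fun z : Fin K × Fin n → ℝ =>
        (fun y : ℝ => if (n - 1) ∣ stepNum p then y else 0) (z p)) z := by
    ext1 z
    rw [output_eq hn, Finset.sum_apply]
  have h2 : ∀ p : Fin K × Fin n,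
      MemLp (fun y : ℝ => if (n - 1) ∣ stepNum p then y else 0) 2 ν := fun p => by
    split_ifs
    · exact hν
    · exact MemLp.zero
  have h3 : ∀ p : Fin K × Fin n,
      variance (fun y : ℝ => if (n - 1) ∣ stepNum p then y else 0) ν =
        if (n - 1) ∣ stepNum p then variance id ν else 0 := fun p => by
    split_ifs
    · rfl
    · exact variance_zero ν
  rw [h1, variance_const_add
      (Finset.aestronglyMeasurable_sum _ fun p _ =>
        (memLp_ite_eval hν p ((n - 1) ∣ stepNum p)).aestronglyMeasurable),
    noiseLaw, variance_sum_pi h2]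
  simp only [h3]
  rw [← sum_range_eq_sum_stepNum fun s => if (n - 1) ∣ s then variance id ν else 0,
    ← Finset.sum_filter, Finset.sum_const, nsmul_eq_mul, card_filter_dvd_range _ _ (by omega)]
  push_cast [Nat.cast_sub (show 1 ≤ n by omega)]
  rfl

end Noise

/-! ### Hiding a contribution behind one noise value. -/

/-- The number of the step of `v` that follows the step of `u` in round `k`. -/
def nextObservation (u v : Fin n) (k : ℕ) : ℕ := k * n + u + (v + n - u) % n

/-- The number of the noisy step between the steps of `v` around the step of `u` in round `k`. -/
def noisyStep (u v : Fin n) (k : ℕ) : ℕ := (n - 1) * ((nextObservation u v k - 1) / (n - 1))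

lemma offset_pos {u v : Fin n} (huv : u ≠ v) :
    1 ≤ ((v : ℕ) + n - u) % n ∧ ((v : ℕ) + n - u) % n < n := by
  have hu := u.isLt
  have hv := v.isLt
  refine ⟨?_, Nat.mod_lt _ (by omega)⟩
  rcases lt_or_gt_of_ne (Fin.val_ne_of_ne huv) with h | h
  · have : (v : ℕ) + n - u = (v - u) + n := by omega
    rw [this, Nat.add_mod_right, Nat.mod_eq_of_lt (by omega)]
    omega
  · rw [Nat.mod_eq_of_lt (by omega)]
    omega

lemma nextObservation_mod (u v : Fin n) (k : ℕ) : nextObservation u v k % n = v := by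
  have hu := u.isLt
  have hv := v.isLt
  have h : ((k * n + u) + (v + n - u) : ℕ) = v + n * (k + 1) := by
    have : (u : ℕ) + (v + n - u) = v + n := by omega
    rw [add_assoc, this]; ring
  rw [nextObservation, Nat.add_mod_mod, h, Nat.add_mul_mod_self_left, Nat.mod_eq_of_lt hv]

/-- The noisy step is the last multiple of `n - 1` before the next step of `v`, hence among the `n -
1` steps preceding it. The additive form avoids subtracting `n`, since `v` may have no earlier step
in the first lap. -/
lemma noisyStep_bounds (hn : 2 ≤ n) {u v : Fin n} (huv : u ≠ v) (k : ℕ) :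
    noisyStep u v k < nextObservation u v k ∧ nextObservation u v k < noisyStep u v k + n := by
  have h1 := (offset_pos huv).1
  have h0 : 1 ≤ nextObservation u v k := by rw [nextObservation]; omega
  have h2 := Nat.div_add_mod (nextObservation u v k - 1) (n - 1)
  have h3 := Nat.mod_lt (nextObservation u v k - 1) (show 0 < n - 1 by omega)
  rw [noisyStep]
  omega

/-- Distinct rounds belong to disjoint blocks between steps of `v`. Each noise value therefore
absorbs at most one changed contribution, and a single use of local privacy suffices for it. -/
lemma noisyStep_injective (hn : 2 ≤ n) {u v : Fin n} (huv : u ≠ v) :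
    Function.Injective (noisyStep u v) := by
  refine StrictMono.injective (strictMono_nat_of_lt_succ fun k => ?_)
  have h1 := (noisyStep_bounds hn huv k).1
  have h2 := (noisyStep_bounds hn huv (k + 1)).2
  have h3 : nextObservation u v (k + 1) = nextObservation u v k + n := by
    rw [nextObservation, nextObservation]; ring
  omega

/-- From the point of view of `v`, the contribution of `u` in round `k` and the noise of the
corresponding noisy step enter simultaneously. -/
lemma noisyStep_le_iff (hn : 2 ≤ n) {u v : Fin n} (huv : u ≠ v) (k s : ℕ)
    (hs : userAt hn s = v ∨ next (userAt hn s) = v) :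
    noisyStep u v k ≤ s ↔ k * n + u ≤ s := by
  obtain ⟨h1, h2⟩ := noisyStep_bounds hn huv k
  obtain ⟨h3, h4⟩ := offset_pos huv
  have h5 := nextObservation_mod u v k
  have h6 : nextObservation u v k = k * n + u + (v + n - u) % n := rfl
  obtain ⟨j, hj⟩ : ∃ j, nextObservation u v k = n * j + v :=
    ⟨_, by rw [← h5]; exact (Nat.div_add_mod _ _).symm⟩
  have hs' : s % n = v ∨ (s + 1) % n = v := by
    rcases hs with h | h
    · exact .inl (congrArg Fin.val h)
    · right
      have := congrArg Fin.val h
      simpa [next, userAt, Nat.mod_add_mod] using this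
  obtain ⟨i, hi⟩ : ∃ i, s = n * i + v ∨ s + 1 = n * i + v := by
    rcases hs' with h | h
    · exact ⟨s / n, .inl (by rw [← h]; exact (Nat.div_add_mod _ _).symm)⟩
    · exact ⟨(s + 1) / n, .inr (by rw [← h]; exact (Nat.div_add_mod _ _).symm)⟩
  -- Either `s` is at least the step just before the next step of `v`, and both events have
  -- happened, or `s` is at most the preceding step of `v`, and neither has.
  rcases le_or_gt j i with hji | hji
  · have : n * j ≤ n * i := Nat.mul_le_mul_left n hji
    omega
  · have : n * (i + 1) ≤ n * j := Nat.mul_le_mul_left n hji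
    rw [Nat.mul_add, mul_one] at this
    omega

/-- The shift of the noise values that compensates, in the view of `v`, a change by `d k` of the
contribution of `u` in each round `k`. -/
def noiseShift (u v : Fin n) (d : Fin K → ℝ) (p : Fin K × Fin n) : ℝ :=
  ∑ k : Fin K, if noisyStep u v k = stepNum p then d k else 0

/-- The two sums differ by Σ_k d_k ([kn + u ≤ s] - [noisyStep ≤ s]), and every bracket vanishes at
an observed step. A noisy step past the end of the run needs no shift, as `v` then never sees the
contribution. -/
lemma partialSum_add_noiseShift (hn : 2 ≤ n) {u v : Fin n} (huv : u ≠ v)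
    {x x' : Fin n → Fin K → ℝ} (hx : ∀ w, w ≠ u → x w = x' w) (z : Fin K × Fin n → ℝ) {s : ℕ}
    (hsK : s < K * n) (hs : userAt hn s = v ∨ next (userAt hn s) = v) :
    partialSum n (byNum fun p => x p.2 p.1) (byNum z) (s + 1) =
      partialSum n (byNum fun p => x' p.2 p.1)
        (byNum (z + noiseShift u v fun k => x u k - x' u k)) (s + 1) := by
  rw [← sub_eq_zero, partialSum, partialSum, ← Finset.sum_sub_distrib]
  set d : Fin K → ℝ := fun k => x u k - x' u k with hd
  have hterm : ∀ r ∈ Finset.range (s + 1),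
      ((byNum (fun p => x p.2 p.1) r + if (n - 1) ∣ r then byNum z r else 0) -
        (byNum (fun p => x' p.2 p.1) r +
          if (n - 1) ∣ r then byNum (z + noiseShift u v d) r else 0)) =
      ∑ k : Fin K, ((if (k : ℕ) * n + u = r then d k else 0) -
        if noisyStep u v k = r then d k else 0) := by
    intro r hr
    obtain ⟨⟨k, w⟩, rfl⟩ : ∃ p : Fin K × Fin n, stepNum p = r :=
      exists_stepNum_eq ((Nat.lt_succ_iff.1 (Finset.mem_range.1 hr)).trans_lt hsK)
    simp only [byNum_stepNum]
    have h1 : x w k - x' w k =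
        ∑ k' : Fin K, if (k' : ℕ) * n + u = stepNum (k, w) then d k' else 0 := by
      have h : ∀ k' : Fin K, (k' : ℕ) * n + u = stepNum (k, w) ↔ k' = k ∧ u = w := fun k' => by
        rw [show (k' : ℕ) * n + u = stepNum (k', u) from rfl, stepNum_injective.eq_iff,
          Prod.mk.injEq]
      simp only [h]
      by_cases hw : u = w
      · subst hw; simp [hd]
      · simp [hw, hx w (Ne.symm hw)]
    have h2 : (if (n - 1) ∣ stepNum (k, w) then noiseShift u v d (k, w) else 0) =
        ∑ k' : Fin K, if noisyStep u v k' = stepNum (k, w) then d k' else 0 := by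
      split_ifs with h
      · rfl
      · refine (Finset.sum_eq_zero fun k' _ => if_neg fun hk => h ?_).symm
        rw [← hk]; exact Dvd.intro _ rfl
    rw [Finset.sum_sub_distrib, ← h1, ← h2]
    split_ifs
    · rw [Pi.add_apply]; ring
    · ring
  rw [Finset.sum_congr rfl hterm, Finset.sum_comm]
  refine Finset.sum_eq_zero fun k _ => ?_
  rw [Finset.sum_sub_distrib, Finset.sum_ite_eq, Finset.sum_ite_eq]
  simp only [Finset.mem_range, Nat.lt_succ_iff, noisyStep_le_iff hn huv k s hs, sub_self]

lemma obs_log_run_add_noiseShift (hn : 2 ≤ n) {u v : Fin n} (huv : u ≠ v)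
    {x x' : Fin n → Fin K → ℝ} (hx : ∀ w, w ≠ u → x w = x' w) (z : Fin K × Fin n → ℝ) :
    (run x z).log.obs v =
      (run x' (z + noiseShift u v fun k => x u k - x' u k)).log.obs v := by
  rw [obs_log_run hn, obs_log_run hn]
  refine List.map_congr_left fun s hs => ?_
  simp only [observed, List.mem_filter, List.mem_range, decide_eq_true_eq] at hs
  rw [partialSum_add_noiseShift hn huv hx z hs.1 hs.2]

/-! ### From local to network privacy. -/

/-- Subtracting x' from the outputs of `perturb` on x and x' leaves Z + (x - x') and Z; exchanging x
and x' gives the second bound. -/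
lemma map_add_real_le_of_isLDP {X : Set ℝ} {ν : Measure ℝ} [IsProbabilityMeasure ν] {ε δ : ℝ}
    (hLDP : IsLDP ν (fun (x : X) (z : ℝ) => perturb (x : ℝ) z) ε δ) (x x' : X) {S : Set ℝ}
    (hS : MeasurableSet S) :
    (ν.map (· + ((x : ℝ) - x'))).real S ≤ Real.exp ε * ν.real S + δ ∧
      ν.real S ≤ Real.exp ε * (ν.map (· + ((x : ℝ) - x'))).real S + δ := by
  have hm : MeasurableSet ((fun y : ℝ => y - x') ⁻¹' S) := (measurable_sub_const _) hS
  have h1 := hLDP x x' _ hm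
  have h2 := hLDP x' x _ hm
  have e1 : {z : ℝ | perturb (x : ℝ) z ∈ (fun y : ℝ => y - x') ⁻¹' S} =
      (· + ((x : ℝ) - x')) ⁻¹' S := by
    ext z
    simp only [perturb, Set.mem_ofPred_eq, Set.mem_preimage]
    rw [show (x : ℝ) + z - x' = z + (x - x') by ring]
  have e2 : {z : ℝ | perturb (x' : ℝ) z ∈ (fun y : ℝ => y - x') ⁻¹' S} = S := by
    ext z
    simp [perturb]
  rw [e1, e2] at h1 h2
  rw [map_measureReal_apply (measurable_add_const _) hS]
  exact ⟨h1, h2⟩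

lemma isNetworkDP_transcript (hn : 2 ≤ n) {ε δ : ℝ} (hε : 0 < ε) (hδ : 0 ≤ δ) {X : Set ℝ}
    {ν : Measure ℝ} [IsProbabilityMeasure ν]
    (hLDP : IsLDP ν (fun (x : X) (z : ℝ) => perturb (x : ℝ) z) ε δ) {δ' : ℝ} (hδ' : 0 < δ') :
    IsNetworkDP (noiseLaw K n ν)
      (transcript : (Fin n → Fin K → X) → (Fin K × Fin n → ℝ) → Transcript (Fin n) ℝ)
      (√(2 * K * Real.log (1 / δ')) * ε + K * ε * (Real.exp ε - 1)) (K * δ + δ') := by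
  classical
  intro u v huv D D' hD S hS
  set d : Fin K → ℝ := fun k => (D u k : ℝ) - D' u k with hd
  set w := noiseShift u v d with hw
  have hview : ∀ z, (transcript D z).obs v = (transcript D' (z + w)).obs v := fun z =>
    obs_log_run_add_noiseShift hn huv (fun a ha => by rw [hD a ha]) z
  have hT : MeasurableSet {z : Fin K × Fin n → ℝ | (transcript D' z).obs v ∈ S} :=
    measurable_obs_log_run hn v _ hS
  set T := {z : Fin K × Fin n → ℝ | (transcript D' z).obs v ∈ S}
  have hprob : ∀ p, IsProbabilityMeasure (ν.map (· + w p)) := fun p =>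
    Measure.isProbabilityMeasure_map (measurable_add_const _).aemeasurable
  have hpi : (noiseLaw K n ν).map (fun z => z + w) = Measure.pi fun p => ν.map (· + w p) :=
    Measure.pi_map_pi (f := fun p y => y + w p) fun p => (measurable_add_const _).aemeasurable
  have hmeas : (noiseLaw K n ν).real {z | (transcript D z).obs v ∈ S} =
      (Measure.pi fun p => ν.map (· + w p)).real T := by
    rw [← hpi, map_measureReal_apply (measurable_add_const _) hT]
    simp only [hview]
    rfl
  rw [hmeas]
  set J : Finset (Fin K × Fin n) :=
    Finset.univ.filter fun p => ∃ k : Fin K, noisyStep u v k = stepNum p with hJ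
  -- One noise value per round at most; in the last round it may lie beyond the run.
  have hcard : J.card ≤ K := by
    rw [← Finset.card_image_of_injective J stepNum_injective]
    have hsub : J.image stepNum ⊆ Finset.univ.image fun k : Fin K => noisyStep u v k := by
      intro s hs
      obtain ⟨p, hp, rfl⟩ := Finset.mem_image.1 hs
      obtain ⟨k, hk⟩ := (Finset.mem_filter.1 hp).2
      exact Finset.mem_image.2 ⟨k, Finset.mem_univ _, hk⟩
    exact (Finset.card_le_card hsub).trans (Finset.card_image_le.trans (by simp))
  have hwJ : ∀ p ∈ J, ∃ k, w p = (D u k : ℝ) - D' u k := by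
    intro p hp
    obtain ⟨k, hk⟩ := (Finset.mem_filter.1 hp).2
    refine ⟨k, ?_⟩
    have h : ∀ k' : Fin K, noisyStep u v k' = stepNum p ↔ k' = k := fun k' => by
      rw [← hk, (noisyStep_injective hn huv).eq_iff, Fin.val_inj]
    simp [hw, noiseShift, h, hd]
  have hwJ' : ∀ p ∉ J, w p = 0 := fun p hp =>
    Finset.sum_eq_zero fun k _ => if_neg fun hk =>
      hp (Finset.mem_filter.2 ⟨Finset.mem_univ _, k, hk⟩)
  refine pi_real_le_of_indistinguishable _ _ hε hδ hδ' J hcard ?_ ?_ ?_ hT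
  · intro p hp A hA
    obtain ⟨k, hk⟩ := hwJ p hp
    rw [hk]
    exact (map_add_real_le_of_isLDP hLDP (D u k) (D' u k) hA).1
  · intro p hp A hA
    obtain ⟨k, hk⟩ := hwJ p hp
    rw [hk]
    exact (map_add_real_le_of_isLDP hLDP (D u k) (D' u k) hA).2
  · intro p hp
    simp [hwJ' p hp]

end RingSum

end

theorem theorem1 (n K : ℕ) (hn : 2 ≤ n) (ε δ σ_loc : ℝ) (hε : 0 < ε) (hδ : 0 < δ)
    -- the set of admissible contributions
    (X : Set ℝ)
    -- the law of the noise of `Perturb(·; σ_loc)`: centered, with standard deviation `σ_loc`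
    (ν : Measure ℝ) [IsProbabilityMeasure ν] (hν : MemLp id 2 ν)
    (hmean : ∫ z, z ∂ν = 0) (hstd : √(variance id ν) = σ_loc)
    (hLDP : IsLDP ν (fun (x : X) (z : ℝ) => RingSum.perturb (x : ℝ) z) ε δ) :
    -- the noise enters at exactly one hop out of `n - 1`
    (∀ (x : Fin n → Fin K → ℝ) (z : Fin K × Fin n → ℝ),
      RingSum.output x z = (∑ u, ∑ k, x u k) +
        ∑ k : Fin K, ∑ u : Fin n, if (n - 1) ∣ (k : ℕ) * n + (u : ℕ) then z (k, u) else 0) ∧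
    -- unbiased estimate of the sum, with its standard deviation
    (∀ x : Fin n → Fin K → ℝ,
      MemLp (RingSum.output x) 2 (RingSum.noiseLaw K n ν) ∧
      ∫ z, RingSum.output x z ∂(RingSum.noiseLaw K n ν) = ∑ u, ∑ k, x u k ∧
      √(variance (RingSum.output x) (RingSum.noiseLaw K n ν)) =
        √(⌈((K : ℝ) * n) / ((n : ℝ) - 1)⌉₊ : ℝ) * σ_loc) ∧
    -- network differential privacy
    (∀ δ' : ℝ, 0 < δ' →
      IsNetworkDP (RingSum.noiseLaw K n ν)
        (RingSum.transcript : (Fin n → Fin K → X) → (Fin K × Fin n → ℝ) →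
          Transcript (Fin n) ℝ)
        (√(2 * K * Real.log (1 / δ')) * ε + K * ε * (Real.exp ε - 1))
        (K * δ + δ')) := by
  refine ⟨fun x z => ?_, fun x => ⟨RingSum.memLp_output hn hν x,
    RingSum.integral_output hn hν hmean x, ?_⟩, fun δ' hδ' =>
      RingSum.isNetworkDP_transcript hn hε hδ.le hLDP hδ'⟩
  · rw [RingSum.output_eq hn, Fintype.sum_prod_type]
    rfl
  · rw [RingSum.variance_output hn hν, Real.sqrt_mul (Nat.cast_nonneg _), hstd]
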